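/- Let $d \ge 2$ and $m \ge 1$ be integers and let $0 \le f \le 1$. For an integer $k\ge 1$ let $\Psi_k = |\Psi_k\rangle\langle\Psi_k|$ with $|\Psi_k\rangle = \frac{1}{\sqrt k}\sum_{i=1}^k |ii\rangle \in \mathbb{C}^k\otimes\mathbb{C}^k$, and let $$\rho_f = f\,\Psi_d + \frac{1-f}{d^2-1}\,(\mathbb{1}-\Psi_d)$$ be the isotropic state on $AB$, where $A=B=\mathbb{C}^d$. Write $X^{T_B}$ for the partial transpose on the second party and $\|\cdot\|_1$ for the trace norm. For a bipartite system, let $\mathsf{SEP}$ be the convex hull of the projectors onto unit product vectors, let $\mathsf{PPT}_+ = \{X \succeq 0 : \operatorname{Tr}X=1,\ X^{T_B}\succeq 0\}$, and let $\mathsf{R}=\{X\succeq 0 : \|X^{T_B}\|_1\le 1\}$ be the Rains set. Consider completely positive trace-preserving linear maps $\Lambda$ from operators on $AB$ to operators on $A'B'$, where $A'=B'=\mathbb{C}^m$, and let $J_\Lambda=\sum_{x,y}|x\rangle\langle y|\otimes\Lambda(|x\rangle\langle y|)$ be the (unnormalised) Choi matrix, $x,y$ ranging over the product basis of $AB$.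 Such a map $\Lambda$ belongs to * $\mathrm{SEP}$ if $J_\Lambda$ is separable across $AA'|BB'$, i.e. a nonnegative multiple of a separable state; * $\mathrm{PPT}$ if $J_\Lambda^{T_{BB'}}\succeq 0$; * the Rains-preserving operations if $X\in\mathsf{R}\Rightarrow\Lambda(X)\in\mathsf{R}$; * the $\mathsf{PPT}_+$-preserving operations if $\sigma\in\mathsf{PPT}_+\Rightarrow\Lambda(\sigma)\in\mathsf{PPT}_+$; * the separability-preserving operations $\mathrm{SEPP}$ if $\sigma\in\mathsf{SEP}\Rightarrow\Lambda(\sigma)\in\mathsf{SEP}$. For each of these five classes $\mathcal{O}$ let $F_{\mathcal O}(\rho_f,m)=\sup_{\Lambda\in\mathcal O}\operatorname{Tr}\big(\Lambda(\rho_f)\Psi_m\big)$ be the fidelity of distillation. Then, for each of the five classes $\mathcal O$: * if $f\le \frac1d$, then $F_{\mathcal O}(\rho_f,m)=\frac1m$; * if $f\ge\frac1d$ and $m\le d$, then $$F_{\mathcal O}(\rho_f,m)=\frac{df-1}{d-1}+\frac{d(1-f)}{m(d-1)}.$$ In particular, all five classes achieve the same fidelity of distillation in these cases. -/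

import Mathlib

namespace EntDist

open scoped ComplexOrder

/-- Operators on the bipartite space `ℂ^A ⊗ ℂ^B`, as matrices in the product basis. -/
abbrev BipOp (A B : Type) : Type := Matrix (A × B) (A × B) ℂ

/-- Linear maps from operators on `AB` to operators on `A'B'`. -/
abbrev BipMap (A B A' B' : Type) : Type := BipOp A B →ₗ[ℂ] BipOp A' B'

/-- Partial transpose on the second tensor factor. -/
def partialTranspose {A B : Type} (X : BipOp A B) : BipOp A B :=
  Matrix.of fun p q => X (p.1, q.2) (q.1, p.2)

/-- The trace norm: the sum of the singular values. -/
noncomputable def traceNorm {n : Type} [Fintype n] [DecidableEq n] (M : Matrix n n ℂ) : ℝ :=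
  ∑ i, Real.sqrt ((Matrix.isHermitian_conjTranspose_mul_self M).eigenvalues i)

section States

variable (A B : Type) [Fintype A] [Fintype B]

/-- The rank-one operators `|ψ⟩⟨ψ|` with `|ψ⟩ = |φ⟩ ⊗ |η⟩` for unit vectors `φ`, `η`. -/
def productProjectors : Set (BipOp A B) :=
  {X | ∃ (φ : A → ℂ) (η : B → ℂ), star φ ⬝ᵥ φ = 1 ∧ star η ⬝ᵥ η = 1 ∧
    X = Matrix.vecMulVec (fun p : A × B => φ p.1 * η p.2)
      (star fun p : A × B => φ p.1 * η p.2)}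

/-- The separable states. -/
def sepStates : Set (BipOp A B) := convexHull ℝ (productProjectors A B)

/-- The states with positive partial transpose. -/
def pptPlusStates : Set (BipOp A B) :=
  {X | X.trace = 1 ∧ X.PosSemidef ∧ (partialTranspose X).PosSemidef}

/-- The Rains set: positive semidefinite operators whose partial transpose has trace norm at
most one. -/
def rainsSet [DecidableEq A] [DecidableEq B] : Set (BipOp A B) :=
  {X | X.PosSemidef ∧ traceNorm (partialTranspose X) ≤ 1}

end States

/-- The action of `id_k ⊗ Λ`. -/
def ampliation {n n' : Type} (k : ℕ) (Λ : Matrix n n ℂ →ₗ[ℂ] Matrix n' n' ℂ)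
    (M : Matrix (Fin k × n) (Fin k × n) ℂ) : Matrix (Fin k × n') (Fin k × n') ℂ :=
  Matrix.of fun p q => Λ (Matrix.of fun a b => M (p.1, a) (q.1, b)) p.2 q.2

/-- Completely positive and trace-preserving linear maps. -/
structure IsCPTP {n n' : Type} [Fintype n] [Fintype n']
    (Λ : Matrix n n ℂ →ₗ[ℂ] Matrix n' n' ℂ) : Prop where
  completelyPositive : ∀ (k : ℕ) (M : Matrix (Fin k × n) (Fin k × n) ℂ),
    M.PosSemidef → (ampliation k Λ M).PosSemidef
  tracePreserving : ∀ M : Matrix n n ℂ, (Λ M).trace = M.trace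

/-- The (unnormalised) Choi matrix `J_Λ = ∑ |ab⟩⟨ce| ⊗ Λ(|ab⟩⟨ce|)`, with the tensor factors
grouped according to the bipartition `AA' | BB'`. -/
def choi {A B A' B' : Type} [DecidableEq A] [DecidableEq B] (Λ : BipMap A B A' B') :
    BipOp (A × A') (B × B') :=
  Matrix.of fun p q =>
    Λ (Matrix.single (p.1.1, p.2.1) (q.1.1, q.2.1) 1) (p.1.2, p.2.2) (q.1.2, q.2.2)

section Operations

variable (A B A' B' : Type) [Fintype A] [Fintype B] [Fintype A'] [Fintype B']

/-- Separable operations: channels whose Choi matrix is separable across `AA' | BB'`, that is, a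
nonnegative multiple of a separable state. -/
def sepOps [DecidableEq A] [DecidableEq B] : Set (BipMap A B A' B') :=
  {Λ | IsCPTP Λ ∧ ∃ t : ℝ, 0 ≤ t ∧ ∃ σ ∈ sepStates (A × A') (B × B'), choi Λ = t • σ}

/-- PPT operations: channels whose Choi matrix has a positive semidefinite partial transpose
across `AA' | BB'`. -/
def pptOps [DecidableEq A] [DecidableEq B] : Set (BipMap A B A' B') :=
  {Λ | IsCPTP Λ ∧ (partialTranspose (choi Λ)).PosSemidef}

/-- Rains-preserving operations: channels mapping the Rains set into the Rains set. -/
def rainsPreservingOps [DecidableEq A] [DecidableEq B] [DecidableEq A'] [DecidableEq B'] :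
    Set (BipMap A B A' B') :=
  {Λ | IsCPTP Λ ∧ ∀ X ∈ rainsSet A B, Λ X ∈ rainsSet A' B'}

/-- Channels mapping states with positive partial transpose to such states. -/
def pptPlusPreservingOps : Set (BipMap A B A' B') :=
  {Λ | IsCPTP Λ ∧ ∀ σ ∈ pptPlusStates A B, Λ σ ∈ pptPlusStates A' B'}

/-- Separability-preserving operations: channels mapping separable states to separable states. -/
def sepPreservingOps : Set (BipMap A B A' B') :=
  {Λ | IsCPTP Λ ∧ ∀ σ ∈ sepStates A B, Λ σ ∈ sepStates A' B'}

end Operations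

/-- The vector `∑ i, |ii⟩ / √m`. -/
noncomputable def maxEntVec (m : ℕ) : Fin m × Fin m → ℂ :=
  fun p => if p.1 = p.2 then ((1 / Real.sqrt m : ℝ) : ℂ) else 0

/-- The maximally entangled state `Ψ_m` of local dimension `m`. -/
noncomputable def maxEnt (m : ℕ) : BipOp (Fin m) (Fin m) :=
  Matrix.vecMulVec (maxEntVec m) (star (maxEntVec m))

/-- The fidelity of distillation: the supremum of `⟨Λ(ρ), Ψ_m⟩` over `Λ` in the class `O`, with
the Hilbert–Schmidt inner product. -/
noncomputable def fidelityOfDistillation {A B : Type} {m : ℕ}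
    (O : Set (BipMap A B (Fin m) (Fin m))) (ρ : BipOp A B) : ℝ :=
  sSup ((fun Λ : BipMap A B (Fin m) (Fin m) => (((Λ ρ).conjTranspose * maxEnt m).trace).re) '' O)

/-- The isotropic state `f Ψ_d + (1 - f) / (d² - 1) (𝟙 - Ψ_d)`. -/
noncomputable def isotropic (d : ℕ) (f : ℝ) : BipOp (Fin d) (Fin d) :=
  f • maxEnt d + ((1 - f) / ((d : ℝ) ^ 2 - 1)) • (1 - maxEnt d)

end EntDist

/-!
All five classes lie between the separable operations and the channels mapping separable states
into the Rains set, so it suffices to bound the fidelity for the latter and to attain the bound by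
separable operations. The inclusions hold because a separable operation preserves the cone of
separable operators, and a PPT operation remains positive when conjugated with the partial
transpose.

*Upper bound.* The partial transpose of `Ψ_m` is `1 / m` times the swap, which lies between `-1`
and `1`, so operators in the Rains set have fidelity at most `1 / m` with `Ψ_m`. The isotropic state
is separable for `f ≤ 1 / d`: its cone is spanned by `Ψ_d + 𝟙 / d` and `𝟙 - Ψ_d`, which up to
diagonal operators are twirls, under `U ⊗ Ū` with `U` diagonal, of products. For `f ≥ 1 / d` it is a
mixture of `Ψ_d`, contributing fidelity at most `1`, and of the separable isotropic state with
`f = 1 / d`, contributing at most `1 / m`.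

*Lower bound.* Preparing a product state `|ii⟩` gives `1 / m`. For `m ≤ d` both parties measure
whether their system lies in a common block of `m` basis vectors, the blocks being shifted
cyclically so that `m` need not divide `d`: on `Ψ_d` the test succeeds and leaves `Ψ_m`, and
whenever it fails they prepare `|ii⟩`.
-/

namespace EntDist

open Matrix
open scoped ComplexOrder Kronecker MatrixOrder

section TraceNorm

variable {n : Type} [Fintype n]

theorem re_trace_mul_nonneg {P Q : Matrix n n ℂ} (hP : P.PosSemidef) (hQ : Q.PosSemidef) :
    0 ≤ (P * Q).trace.re := by
  classical
  obtain ⟨D, rfl⟩ := CStarAlgebra.nonneg_iff_eq_star_mul_self.mp hP.nonneg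
  rw [Matrix.mul_assoc, trace_mul_comm]
  exact (Complex.le_def.1 (hQ.mul_mul_conjTranspose_same D).trace_nonneg).1

variable [DecidableEq n]

theorem re_trace_sub_mul_le {P Q S : Matrix n n ℂ} (hP : P.PosSemidef) (hQ : Q.PosSemidef)
    (hS : -1 ≤ S) (hS' : S ≤ 1) : ((P - Q) * S).trace.re ≤ P.trace.re + Q.trace.re := by
  have hPS := re_trace_mul_nonneg hP (le_iff.1 hS')
  have hQS := re_trace_mul_nonneg hQ (le_iff.1 hS)
  simp only [Matrix.mul_sub, Matrix.mul_neg, Matrix.sub_mul, Matrix.mul_one, trace_sub, trace_neg,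
    Complex.sub_re, Complex.neg_re] at *
  linarith

theorem traceNorm_eq_re_trace_abs (M : Matrix n n ℂ) :
    traceNorm M = (CFC.abs M).trace.re := by
  have hM := isHermitian_conjTranspose_mul_self M
  rw [CFC.abs, star_eq_conjTranspose,
    CFC.sqrt_eq_real_sqrt _ (posSemidef_conjTranspose_mul_self M).nonneg, cfcₙ_eq_cfc,
    hM.cfc_eq, IsHermitian.cfc, Unitary.conjStarAlgAut_apply, trace_mul_cycle,
    Unitary.coe_star_mul_self, Matrix.one_mul, trace_diagonal]
  simp [traceNorm]

theorem traceNorm_eq_re_trace_posPart_add_negPart {H : Matrix n n ℂ} (hH : H.IsHermitian) :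
    traceNorm H = (H⁺).trace.re + (H⁻).trace.re := by
  rw [traceNorm_eq_re_trace_abs, ← CFC.posPart_add_negPart H hH.isSelfAdjoint, trace_add,
    Complex.add_re]

theorem re_trace_mul_le_traceNorm {H S : Matrix n n ℂ} (hH : H.IsHermitian) (hS : -1 ≤ S)
    (hS' : S ≤ 1) : (H * S).trace.re ≤ traceNorm H := by
  rw [traceNorm_eq_re_trace_posPart_add_negPart hH]
  nth_rw 1 [← CFC.posPart_sub_negPart H hH.isSelfAdjoint]
  exact re_trace_sub_mul_le (CFC.posPart_nonneg H).posSemidef (CFC.negPart_nonneg H).posSemidef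
    hS hS'

theorem exists_traceNorm_eq_re_trace_mul {H : Matrix n n ℂ} (hH : H.IsHermitian) :
    ∃ S : Matrix n n ℂ, -1 ≤ S ∧ S ≤ 1 ∧ traceNorm H = (H * S).trace.re := by
  have hcont (g : ℝ → ℝ) : ContinuousOn g (spectrum ℝ H) := H.finite_real_spectrum.continuousOn g
  let sign : ℝ → ℝ := fun x => SignType.sign x
  have habs_sign (x : ℝ) : |sign x| ≤ 1 := by
    rcases lt_trichotomy x 0 with h | h | h <;> simp [sign, h]
  refine ⟨cfc sign H, ?_, ?_, ?_⟩
  · simpa using algebraMap_le_cfc sign (-1) H (fun x _ => (abs_le.1 (habs_sign x)).1) (hcont _)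
      hH.isSelfAdjoint
  · exact cfc_le_one sign H fun x _ => (abs_le.1 (habs_sign x)).2
  · rw [traceNorm_eq_re_trace_abs, CFC.abs_eq_cfc_norm H hH.isSelfAdjoint]
    congr 3
    nth_rw 2 [← cfc_id ℝ H hH.isSelfAdjoint]
    rw [← cfc_mul _ _ _ (hcont _) (hcont _)]
    exact cfc_congr fun x _ => (self_mul_sign x).symm

theorem traceNorm_sub_le {P Q : Matrix n n ℂ} (hP : P.PosSemidef) (hQ : Q.PosSemidef) :
    traceNorm (P - Q) ≤ P.trace.re + Q.trace.re := by
  obtain ⟨S, hS, hS', hPQ⟩ :=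
    exists_traceNorm_eq_re_trace_mul (hP.isHermitian.sub hQ.isHermitian)
  exact hPQ.le.trans (re_trace_sub_mul_le hP hQ hS hS')

end TraceNorm

section Conjugation

variable {n n' : Type} [Fintype n]

/-- The map `X ↦ K X Kᴴ`, the building block of Kraus representations. -/
@[simps]
def conjMap (K : Matrix n' n ℂ) : Matrix n n ℂ →ₗ[ℂ] Matrix n' n' ℂ where
  toFun X := K * X * Kᴴ
  map_add' X Y := by rw [Matrix.mul_add, Matrix.add_mul]
  map_smul' c X := by rw [Matrix.mul_smul, Matrix.smul_mul, RingHom.id_apply]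

end Conjugation

section PartialTranspose

variable {A B : Type}

/-- The involution exchanging the second components of two index pairs: it is the index permutation
underlying the partial transpose. -/
def exchangeSnd (A B : Type) : (A × B) × A × B ≃ (A × B) × A × B where
  toFun z := ((z.1.1, z.2.2), (z.2.1, z.1.2))
  invFun z := ((z.1.1, z.2.2), (z.2.1, z.1.2))

/-- The partial transpose as a linear map. -/
@[simps]
def partialTransposeLM : BipOp A B →ₗ[ℂ] BipOp A B where
  toFun := partialTranspose
  map_add' _ _ := rfl
  map_smul' _ _ := rfl

theorem isHermitian_partialTranspose {X : BipOp A B} (hX : X.IsHermitian) :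
    (partialTranspose X).IsHermitian :=
  IsHermitian.ext fun p q => hX.apply (p.1, q.2) (q.1, p.2)

theorem partialTranspose_kronecker (P : Matrix A A ℂ) (Q : Matrix B B ℂ) :
    partialTranspose (P ⊗ₖ Q) = P ⊗ₖ Qᵀ := rfl

theorem trace_partialTranspose_mul_partialTranspose [Fintype A] [Fintype B] (X Y : BipOp A B) :
    (partialTranspose X * partialTranspose Y).trace = (X * Y).trace := by
  simp only [trace, diag_apply, mul_apply, ← Fintype.sum_prod_type']
  exact Fintype.sum_equiv (exchangeSnd A B) _ _ fun _ => rfl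

end PartialTranspose

section Separable

variable {A B A' B' : Type}

theorem vecMulVec_kronecker_vecMulVec_star (φ : A → ℂ) (η : B → ℂ) :
    vecMulVec φ (star φ) ⊗ₖ vecMulVec η (star η) =
      vecMulVec (fun p : A × B => φ p.1 * η p.2) (star fun p : A × B => φ p.1 * η p.2) := by
  ext p q
  simp only [kroneckerMap_apply, vecMulVec_apply, Pi.star_apply, star_mul']
  ring

variable [Fintype A] [Fintype B] [Fintype A'] [Fintype B']

variable (A B) in
/-- The cone of separable operators without normalisation. -/
noncomputable def sepCone : PointedCone ℝ (BipOp A B) := PointedCone.hull ℝ (productProjectors A B)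

theorem exists_vecMulVec_star_eq_smul {φ : A → ℂ} (hφ : φ ≠ 0) :
    ∃ (r : ℝ) (u : A → ℂ), 0 ≤ r ∧ star u ⬝ᵥ u = 1 ∧
      vecMulVec φ (star φ) = r • vecMulVec u (star u) := by
  obtain ⟨r, hr, hφr⟩ := RCLike.nonneg_iff_exists_ofReal.1 (dotProduct_star_self_nonneg φ)
  have hr0 : r ≠ 0 := by
    rintro rfl
    exact hφ (dotProduct_star_self_eq_zero.1 (by simpa using hφr.symm))
  have hinv : (√r)⁻¹ * (√r)⁻¹ = r⁻¹ := by rw [← mul_inv, Real.mul_self_sqrt hr]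
  refine ⟨r, (√r)⁻¹ • φ, hr, ?_, ?_⟩
  · rw [star_smul, star_trivial (√r)⁻¹, smul_dotProduct, dotProduct_smul, ← hφr, smul_smul, hinv]
    simp [hr0]
  · rw [star_smul, star_trivial (√r)⁻¹, smul_vecMulVec, vecMulVec_smul, smul_smul, smul_smul,
      mul_assoc, hinv, mul_inv_cancel₀ hr0, one_smul]

theorem vecMulVec_kronecker_mem_sepCone (φ : A → ℂ) (η : B → ℂ) :
    vecMulVec φ (star φ) ⊗ₖ vecMulVec η (star η) ∈ sepCone A B := by
  rcases eq_or_ne φ 0 with rfl | hφ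
  · simp
  rcases eq_or_ne η 0 with rfl | hη
  · simp
  obtain ⟨r, u, hr, hu, hφu⟩ := exists_vecMulVec_star_eq_smul hφ
  obtain ⟨s, v, hs, hv, hηv⟩ := exists_vecMulVec_star_eq_smul hη
  rw [hφu, hηv, smul_kronecker, kronecker_smul, vecMulVec_kronecker_vecMulVec_star]
  exact PointedCone.smul_mem _ hr <| PointedCone.smul_mem _ hs <|
    PointedCone.subset_hull ⟨u, v, hu, hv, rfl⟩

theorem kronecker_mem_sepCone {P : Matrix A A ℂ} {Q : Matrix B B ℂ} (hP : P.PosSemidef)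
    (hQ : Q.PosSemidef) : P ⊗ₖ Q ∈ sepCone A B := by
  obtain ⟨k, φ, rfl⟩ := posSemidef_iff_eq_sum_vecMulVec.1 hP
  obtain ⟨l, η, rfl⟩ := posSemidef_iff_eq_sum_vecMulVec.1 hQ
  change kroneckerBilinear (R := ℂ) _ _ ∈ _
  rw [LinearMap.map_sum₂]
  simp only [map_sum]
  exact sum_mem fun i _ => sum_mem fun j _ => vecMulVec_kronecker_mem_sepCone (φ i) (η j)

theorem sepCone_le {C : PointedCone ℝ (BipOp A B)}
    (hC : ∀ (P : Matrix A A ℂ) (Q : Matrix B B ℂ), P.PosSemidef → Q.PosSemidef → P ⊗ₖ Q ∈ C) :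
    sepCone A B ≤ C := by
  refine Submodule.span_le.2 ?_
  rintro _ ⟨φ, η, -, -, rfl⟩
  rw [← vecMulVec_kronecker_vecMulVec_star]
  exact hC _ _ (posSemidef_vecMulVec_self_star φ) (posSemidef_vecMulVec_self_star η)

theorem map_mem_sepCone (F : BipOp A B →ₗ[ℂ] BipOp A' B')
    (hF : ∀ (P : Matrix A A ℂ) (Q : Matrix B B ℂ), P.PosSemidef → Q.PosSemidef →
      F (P ⊗ₖ Q) ∈ sepCone A' B')
    {X : BipOp A B} (hX : X ∈ sepCone A B) : F X ∈ sepCone A' B' :=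
  sepCone_le (C := (sepCone A' B').comap (F.restrictScalars ℝ)) hF hX

theorem partialTranspose_mem_sepCone {X : BipOp A B} (hX : X ∈ sepCone A B) :
    partialTranspose X ∈ sepCone A B :=
  by
  refine map_mem_sepCone partialTransposeLM (fun P Q hP hQ => ?_) hX
  rw [partialTransposeLM_apply, partialTranspose_kronecker]
  exact kronecker_mem_sepCone hP hQ.transpose

theorem posSemidef_of_mem_sepCone {X : BipOp A B} (hX : X ∈ sepCone A B) : X.PosSemidef :=
  nonneg_iff_posSemidef.1 <| sepCone_le (C := PointedCone.positive ℝ (BipOp A B))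
    (fun _ _ hP hQ => (hP.kronecker hQ).nonneg) hX

theorem conjMap_kronecker_mem_sepCone (S : Matrix A' A ℂ) (T : Matrix B' B ℂ) {X : BipOp A B}
    (hX : X ∈ sepCone A B) : conjMap (S ⊗ₖ T) X ∈ sepCone A' B' := by
  refine map_mem_sepCone _ (fun P Q hP hQ => ?_) hX
  rw [conjMap_apply, conjTranspose_kronecker, ← mul_kronecker_mul, ← mul_kronecker_mul]
  exact kronecker_mem_sepCone (hP.mul_mul_conjTranspose_same S) (hQ.mul_mul_conjTranspose_same T)

theorem trace_eq_one_of_mem_productProjectors {X : BipOp A B}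
    (hX : X ∈ productProjectors A B) : X.trace = 1 := by
  obtain ⟨φ, η, hφ, hη, rfl⟩ := hX
  rw [← vecMulVec_kronecker_vecMulVec_star, trace_kronecker, trace_vecMulVec, trace_vecMulVec,
    dotProduct_comm, hφ, dotProduct_comm, hη, one_mul]

theorem mem_sepStates_iff {X : BipOp A B} :
    X ∈ sepStates A B ↔ X ∈ sepCone A B ∧ X.trace = 1 := by
  constructor
  · have hconv : Convex ℝ {Y : BipOp A B | Y.trace = 1} :=
      convex_hyperplane (traceLinearMap (A × B) ℝ ℂ).isLinear 1
    exact fun hX => convexHull_min (t := (sepCone A B : Set (BipOp A B)) ∩ {Y | Y.trace = 1})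
      (fun Y hY => ⟨PointedCone.subset_hull hY, trace_eq_one_of_mem_productProjectors hY⟩)
      ((sepCone A B).convex.inter hconv) hX
  · rintro ⟨hX, htr⟩
    obtain ⟨c, hc, hc0, rfl⟩ := PointedCone.mem_hull_set.1 hX
    refine (convex_convexHull ℝ _).sum_mem (fun Y _ => hc0 Y) ?_
      fun Y hY => subset_convexHull ℝ _ (hc hY)
    rw [Finsupp.sum, trace_sum] at htr
    have htr' : ∀ Y ∈ c.support, (c Y • Y).trace = (c Y : ℂ) := fun Y hY => by
      rw [trace_smul, trace_eq_one_of_mem_productProjectors (hc hY), Complex.real_smul, mul_one]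
    rw [Finset.sum_congr rfl htr'] at htr
    exact_mod_cast htr

theorem sepStates_nonempty [Nonempty A] [Nonempty B] : (sepStates A B).Nonempty := by
  classical
  refine ⟨_, subset_convexHull ℝ _ ⟨Pi.single (Classical.arbitrary A) 1,
    Pi.single (Classical.arbitrary B) 1, ?_, ?_, rfl⟩⟩ <;> simp

theorem exists_eq_smul_sepStates [Nonempty A] [Nonempty B] {X : BipOp A B}
    (hX : X ∈ sepCone A B) : ∃ t : ℝ, 0 ≤ t ∧ ∃ σ ∈ sepStates A B, X = t • σ := by
  have hpos := posSemidef_of_mem_sepCone hX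
  obtain ⟨t, ht, hXt⟩ := RCLike.nonneg_iff_exists_ofReal.1 hpos.trace_nonneg
  rcases eq_or_ne t 0 with rfl | ht0
  · obtain ⟨σ, hσ⟩ := sepStates_nonempty (A := A) (B := B)
    exact ⟨0, le_rfl, σ, hσ, by simpa [hpos.trace_eq_zero_iff] using hXt.symm⟩
  · refine ⟨t, ht, t⁻¹ • X, mem_sepStates_iff.2
      ⟨PointedCone.smul_mem _ (inv_nonneg.2 ht) hX, ?_⟩, (smul_inv_smul₀ ht0 X).symm⟩
    rw [trace_smul, ← hXt]
    simp [ht0]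

theorem sepStates_subset_pptPlusStates : sepStates A B ⊆ pptPlusStates A B := fun X hX => by
  obtain ⟨hX, htr⟩ := mem_sepStates_iff.1 hX
  exact ⟨htr, posSemidef_of_mem_sepCone hX,
    posSemidef_of_mem_sepCone (partialTranspose_mem_sepCone hX)⟩

theorem pptPlusStates_subset_rainsSet [DecidableEq A] [DecidableEq B] :
    pptPlusStates A B ⊆ rainsSet A B := fun X ⟨htr, hX, hpt⟩ => by
  refine ⟨hX, ?_⟩
  have htr' : (partialTranspose X).trace = 1 := htr
  simpa [htr'] using traceNorm_sub_le hpt PosSemidef.zero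

end Separable

section Choi

variable {n n' : Type}

theorem posSemidef_of_ampliation_one {Λ : Matrix n n ℂ →ₗ[ℂ] Matrix n' n' ℂ}
    (hΛ : ∀ M, M.PosSemidef → (ampliation 1 Λ M).PosSemidef) {X : Matrix n n ℂ}
    (hX : X.PosSemidef) : (Λ X).PosSemidef :=
  (hΛ _ (hX.submatrix Prod.snd)).submatrix fun i => (0, i)

variable [Fintype n]

/-- The action of a Choi matrix `C` as a linear map on operators, bilinear in `C` and in the
operator `X` acted upon; it is inverse to forming the Choi matrix of a map. -/
def choiAction : Matrix (n × n') (n × n') ℂ →ₗ[ℂ] Matrix n n ℂ →ₗ[ℂ] Matrix n' n' ℂ :=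
  LinearMap.mk₂ ℂ (fun C X => of fun i j => ∑ a, ∑ b, X a b * C (a, i) (b, j))
    (fun _ _ _ => by ext; simp [mul_add, Finset.sum_add_distrib])
    (fun _ _ _ => by ext; simp [Finset.mul_sum, mul_left_comm])
    (fun _ _ _ => by ext; simp [add_mul, Finset.sum_add_distrib])
    (fun _ _ _ => by ext; simp [Finset.mul_sum, mul_assoc])

theorem choiAction_apply (C : Matrix (n × n') (n × n') ℂ) (X : Matrix n n ℂ) (i j : n') :
    choiAction C X i j = ∑ a, ∑ b, X a b * C (a, i) (b, j) := rfl

theorem posSemidef_ampliation_choiAction [Finite n'] (k : ℕ) {C : Matrix (n × n') (n × n') ℂ}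
    {M : Matrix (Fin k × n) (Fin k × n) ℂ} (hC : C.PosSemidef) (hM : M.PosSemidef) :
    (ampliation k (choiAction C) M).PosSemidef := by
  classical
  have := Fintype.ofFinite n'
  let sumMiddle : Matrix (Fin k × n') (Fin k × n × n') ℂ :=
    of fun p q => if p = (q.1, q.2.2) then 1 else 0
  have hschur : ampliation k (choiAction C) M = conjMap sumMiddle
      (M.submatrix (fun q => (q.1, q.2.1)) (fun q => (q.1, q.2.1)) ⊙
        C.submatrix Prod.snd Prod.snd) := by
    ext p q
    simpa [sumMiddle, ampliation, choiAction_apply, mul_apply, Fintype.sum_prod_type,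
      Finset.sum_mul, Prod.ext_iff, ite_and, apply_ite] using Finset.sum_comm
  rw [hschur]
  exact ((hM.submatrix _).hadamard (hC.submatrix _)).mul_mul_conjTranspose_same sumMiddle

theorem posSemidef_choiAction [Finite n'] {C : Matrix (n × n') (n × n') ℂ} {X : Matrix n n ℂ}
    (hC : C.PosSemidef) (hX : X.PosSemidef) : (choiAction C X).PosSemidef :=
  posSemidef_of_ampliation_one (fun _ => posSemidef_ampliation_choiAction 1 hC) hX

variable {A B A' B' : Type} [Fintype A] [Fintype B]

/-- The bipartite map whose Choi matrix, with the factors grouped as in `choi`, is `C`. -/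
def choiMap : BipOp (A × A') (B × B') →ₗ[ℂ] BipMap A B A' B' :=
  choiAction ∘ₗ (reindexLinearEquiv ℂ ℂ (Equiv.prodProdProdComm A A' B B')
    (Equiv.prodProdProdComm A A' B B')).toLinearMap

theorem choiMap_apply (C : BipOp (A × A') (B × B')) (X : BipOp A B) (p q : A' × B') :
    choiMap C X p q =
      ∑ a, ∑ b, X a b * C ((a.1, p.1), (a.2, p.2)) ((b.1, q.1), (b.2, q.2)) := rfl

theorem choiMap_choi [DecidableEq A] [DecidableEq B] (Λ : BipMap A B A' B') :
    choiMap (choi Λ) = Λ := by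
  refine LinearMap.ext fun X => Matrix.ext fun p q => ?_
  conv_rhs => rw [matrix_eq_sum_single X]
  simp only [choiMap_apply, choi, of_apply, map_sum, Matrix.sum_apply]
  refine Finset.sum_congr rfl fun a _ => Finset.sum_congr rfl fun b _ => ?_
  have hsingle : single a b (X a b) = X a b • single a b 1 := by simp
  rw [hsingle, map_smul, Matrix.smul_apply, smul_eq_mul]

theorem choiMap_kronecker (C : Matrix (A × A') (A × A') ℂ) (D : Matrix (B × B') (B × B') ℂ)
    (X : Matrix A A ℂ) (Y : Matrix B B ℂ) :
    choiMap (C ⊗ₖ D) (X ⊗ₖ Y) = choiAction C X ⊗ₖ choiAction D Y := by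
  ext p q
  simp only [choiMap_apply, kroneckerMap_apply, choiAction_apply, Fintype.sum_prod_type,
    Finset.sum_mul_sum, mul_mul_mul_comm]

theorem posSemidef_choiMap [Finite A'] [Finite B'] {C : BipOp (A × A') (B × B')} {X : BipOp A B}
    (hC : C.PosSemidef) (hX : X.PosSemidef) : (choiMap C X).PosSemidef :=
  posSemidef_choiAction (hC.submatrix _) hX

theorem partialTranspose_choiMap (C : BipOp (A × A') (B × B')) (X : BipOp A B) :
    partialTranspose (choiMap C X) = choiMap (partialTranspose C) (partialTranspose X) := by
  ext p q
  simp only [choiMap_apply, partialTranspose, of_apply, ← Fintype.sum_prod_type']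
  exact Fintype.sum_equiv (exchangeSnd A B) _ _ fun _ => rfl

theorem choiMap_mem_sepCone [Fintype A'] [Fintype B'] {C : BipOp (A × A') (B × B')}
    {X : BipOp A B} (hC : C ∈ sepCone (A × A') (B × B')) (hX : X ∈ sepCone A B) :
    choiMap C X ∈ sepCone A' B' := by
  refine map_mem_sepCone (choiMap C) (fun P Q hP hQ => ?_) hX
  refine map_mem_sepCone (choiMap.flip (P ⊗ₖ Q)) (fun P' Q' hP' hQ' => ?_) hC
  rw [LinearMap.flip_apply, choiMap_kronecker]
  exact kronecker_mem_sepCone (posSemidef_choiAction hP' hP) (posSemidef_choiAction hQ' hQ)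

end Choi

section Operations

variable {A B A' B' : Type} [Fintype A] [Fintype B] [Fintype A'] [Fintype B']

theorem IsCPTP.posSemidef {n n' : Type} [Fintype n] [Fintype n']
    {Λ : Matrix n n ℂ →ₗ[ℂ] Matrix n' n' ℂ} (hΛ : IsCPTP Λ) {X : Matrix n n ℂ}
    (hX : X.PosSemidef) : (Λ X).PosSemidef :=
  posSemidef_of_ampliation_one (hΛ.completelyPositive 1) hX

section Inclusions

variable [DecidableEq A] [DecidableEq B]

theorem choi_mem_sepCone {Λ : BipMap A B A' B'} (hΛ : Λ ∈ sepOps A B A' B') :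
    choi Λ ∈ sepCone (A × A') (B × B') := by
  obtain ⟨-, t, ht, σ, hσ, h⟩ := hΛ
  exact h ▸ PointedCone.smul_mem _ ht (mem_sepStates_iff.1 hσ).1

theorem posSemidef_partialTranspose_map {Λ : BipMap A B A' B'} (hΛ : Λ ∈ pptOps A B A' B')
    {X : BipOp A B} (hX : (partialTranspose X).PosSemidef) :
    (partialTranspose (Λ X)).PosSemidef := by
  rw [← choiMap_choi Λ, partialTranspose_choiMap]
  exact posSemidef_choiMap hΛ.2 hX

theorem sepOps_subset_pptOps : sepOps A B A' B' ⊆ pptOps A B A' B' := fun _ hΛ =>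
  ⟨hΛ.1, posSemidef_of_mem_sepCone (partialTranspose_mem_sepCone (choi_mem_sepCone hΛ))⟩

theorem sepOps_subset_sepPreservingOps : sepOps A B A' B' ⊆ sepPreservingOps A B A' B' :=
  fun Λ hΛ => by
    refine ⟨hΛ.1, fun σ hσ => ?_⟩
    obtain ⟨hσ, htr⟩ := mem_sepStates_iff.1 hσ
    refine mem_sepStates_iff.2 ⟨?_, (hΛ.1.tracePreserving σ).trans htr⟩
    rw [← choiMap_choi Λ]
    exact choiMap_mem_sepCone (choi_mem_sepCone hΛ) hσ

theorem pptOps_subset_pptPlusPreservingOps :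
    pptOps A B A' B' ⊆ pptPlusPreservingOps A B A' B' := fun _ hΛ =>
  ⟨hΛ.1, fun σ hσ => ⟨(hΛ.1.tracePreserving σ).trans hσ.1, hΛ.1.posSemidef hσ.2.1,
    posSemidef_partialTranspose_map hΛ hσ.2.2⟩⟩

theorem traceNorm_partialTranspose_map_le [DecidableEq A'] [DecidableEq B']
    {Λ : BipMap A B A' B'} (hΛ : Λ ∈ pptOps A B A' B') {X : BipOp A B} (hX : X.IsHermitian) :
    traceNorm (partialTranspose (Λ X)) ≤ traceNorm (partialTranspose X) := by
  have hH := isHermitian_partialTranspose hX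
  set P := (partialTranspose X)⁺
  set Q := (partialTranspose X)⁻
  let ΛΓ : BipMap A B A' B' := partialTransposeLM ∘ₗ Λ ∘ₗ partialTransposeLM
  have hpos {Y : BipOp A B} (hY : 0 ≤ Y) : (ΛΓ Y).PosSemidef :=
    posSemidef_partialTranspose_map hΛ hY.posSemidef
  have htr (Y : BipOp A B) : (ΛΓ Y).trace = Y.trace := hΛ.1.tracePreserving (partialTranspose Y)
  calc traceNorm (partialTranspose (Λ X)) = traceNorm (ΛΓ P - ΛΓ Q) := by
        rw [← map_sub, CFC.posPart_sub_negPart _ hH.isSelfAdjoint]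
        rfl
    _ ≤ P.trace.re + Q.trace.re := by
        rw [← htr P, ← htr Q]
        exact traceNorm_sub_le (hpos (CFC.posPart_nonneg _)) (hpos (CFC.negPart_nonneg _))
    _ = traceNorm (partialTranspose X) := (traceNorm_eq_re_trace_posPart_add_negPart hH).symm

theorem pptOps_subset_rainsPreservingOps [DecidableEq A'] [DecidableEq B'] :
    pptOps A B A' B' ⊆ rainsPreservingOps A B A' B' := fun _ hΛ =>
  ⟨hΛ.1, fun _ hX => ⟨hΛ.1.posSemidef hX.1,
    (traceNorm_partialTranspose_map_le hΛ hX.1.isHermitian).trans hX.2⟩⟩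

end Inclusions

variable (A' B' A B) in
/-- Channels mapping separable states into the Rains set: the largest class of operations to which
the bounds on the fidelity of distillation apply. -/
def sepToRainsOps [DecidableEq A'] [DecidableEq B'] : Set (BipMap A B A' B') :=
  {Λ | IsCPTP Λ ∧ ∀ σ ∈ sepStates A B, Λ σ ∈ rainsSet A' B'}

variable [DecidableEq A'] [DecidableEq B']

theorem sepPreservingOps_subset_sepToRainsOps :
    sepPreservingOps A B A' B' ⊆ sepToRainsOps A B A' B' := fun _ hΛ =>
  ⟨hΛ.1, fun σ hσ =>
    pptPlusStates_subset_rainsSet (sepStates_subset_pptPlusStates (hΛ.2 σ hσ))⟩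

theorem pptPlusPreservingOps_subset_sepToRainsOps :
    pptPlusPreservingOps A B A' B' ⊆ sepToRainsOps A B A' B' := fun _ hΛ =>
  ⟨hΛ.1, fun σ hσ =>
    pptPlusStates_subset_rainsSet (hΛ.2 σ (sepStates_subset_pptPlusStates hσ))⟩

theorem rainsPreservingOps_subset_sepToRainsOps [DecidableEq A] [DecidableEq B] :
    rainsPreservingOps A B A' B' ⊆ sepToRainsOps A B A' B' := fun _ hΛ =>
  ⟨hΛ.1, fun σ hσ =>
    hΛ.2 σ (pptPlusStates_subset_rainsSet (sepStates_subset_pptPlusStates hσ))⟩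

theorem mem_Icc_sepOps_sepToRainsOps [DecidableEq A] [DecidableEq B]
    {O : Set (BipMap A B A' B')}
    (hO : O ∈ ({sepOps A B A' B', pptOps A B A' B', rainsPreservingOps A B A' B',
      pptPlusPreservingOps A B A' B', sepPreservingOps A B A' B'} :
        Set (Set (BipMap A B A' B')))) :
    O ∈ Set.Icc (sepOps A B A' B') (sepToRainsOps A B A' B') := by
  have hpptOps : pptOps A B A' B' ⊆ sepToRainsOps A B A' B' :=
    pptOps_subset_rainsPreservingOps.trans rainsPreservingOps_subset_sepToRainsOps
  rcases hO with rfl | rfl | rfl | rfl | rfl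
  · exact ⟨subset_rfl, sepOps_subset_pptOps.trans hpptOps⟩
  · exact ⟨sepOps_subset_pptOps, hpptOps⟩
  · exact ⟨sepOps_subset_pptOps.trans pptOps_subset_rainsPreservingOps,
      rainsPreservingOps_subset_sepToRainsOps⟩
  · exact ⟨sepOps_subset_pptOps.trans pptOps_subset_pptPlusPreservingOps,
      pptPlusPreservingOps_subset_sepToRainsOps⟩
  · exact ⟨sepOps_subset_sepPreservingOps, sepPreservingOps_subset_sepToRainsOps⟩

end Operations

section PhaseTwirl

variable {ι : Type}

/-- The phase `θ p.1 - θ p.2 - θ q.1 + θ q.2` acquired by the matrix entry `(p, q)` of a bipartite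
operator under conjugation by `U ⊗ Ū`, where `U` is diagonal with phases `θ`. -/
@[simps]
def entryPhase (p q : ι × ι) : (ι → ZMod 3) →+ ZMod 3 where
  toFun θ := θ p.1 - θ p.2 - θ q.1 + θ q.2
  map_zero' := by simp
  map_add' θ θ' := by simp only [Pi.add_apply]; ring

theorem entryPhase_eq_zero_iff {p q : ι × ι} :
    entryPhase p q = 0 ↔ p = q ∨ p.1 = p.2 ∧ q.1 = q.2 := by
  classical
  constructor
  · intro h
    have htest (i : ι) := DFunLike.congr_fun h (Pi.single i 1)
    have := htest p.1
    have := htest p.2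
    have := htest q.1
    simp only [entryPhase_apply, Pi.single_apply, AddMonoidHom.zero_apply, Prod.ext_iff] at *
    -- `2 ≠ 0` in `ZMod 3`: square roots of unity would not separate the entries.
    have : (1 : ZMod 3) + 1 ≠ 0 := by decide
    grind
  · rintro (rfl | ⟨hp, hq⟩)
    · ext θ
      simp
    · ext θ
      simp [hp, hq]

variable [DecidableEq ι] [Fintype ι]

/-- The diagonal unitary with the cube roots of unity given by `θ` on the diagonal. -/
noncomputable def phaseUnitary (θ : ι → ZMod 3) : Matrix ι ι ℂ :=
  diagonal fun i => ZMod.stdAddChar (θ i)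

/-- The average over all conjugations by `U ⊗ Ū` with `U` a diagonal unitary. Phases that are cube
roots of unity already give the same average as arbitrary ones. -/
noncomputable def phaseTwirl : BipOp ι ι →ₗ[ℂ] BipOp ι ι :=
  (Fintype.card (ι → ZMod 3) : ℝ)⁻¹ •
    ∑ θ : ι → ZMod 3, conjMap (phaseUnitary θ ⊗ₖ phaseUnitary (-θ))

theorem conjMap_phaseUnitary_apply (θ : ι → ZMod 3) (X : BipOp ι ι) (p q : ι × ι) :
    conjMap (phaseUnitary θ ⊗ₖ phaseUnitary (-θ)) X p q =
      ZMod.stdAddChar (entryPhase p q θ) * X p q := by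
  have hstar (x : ZMod 3) : star (ZMod.stdAddChar x : ℂ) = ZMod.stdAddChar (-x) :=
    (AddChar.map_neg_eq_conj _ x).symm
  simp only [conjMap_apply, phaseUnitary, diagonal_kronecker_diagonal, diagonal_conjTranspose,
    mul_diagonal, diagonal_mul, Pi.star_apply, Pi.neg_apply, star_mul', hstar, neg_neg,
    entryPhase_apply, sub_eq_add_neg, AddChar.map_add_eq_mul]
  ring

theorem phaseTwirl_apply (X : BipOp ι ι) (p q : ι × ι) :
    phaseTwirl X p q = if p = q ∨ p.1 = p.2 ∧ q.1 = q.2 then X p q else 0 := by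
  have hchar : ∑ θ, ZMod.stdAddChar (entryPhase p q θ) =
      if entryPhase p q = 0 then (Fintype.card (ι → ZMod 3) : ℂ) else 0 := by
    have htrivial : ZMod.stdAddChar.compAddMonoidHom (entryPhase p q) = 0 ↔ entryPhase p q = 0 :=
      (AddChar.compAddMonoidHom_injective_right _ ZMod.injective_stdAddChar).eq_iff'
        (by ext; simp)
    classical
    simpa only [htrivial, AddChar.compAddMonoidHom_apply] using
      AddChar.sum_eq_ite (ZMod.stdAddChar.compAddMonoidHom (entryPhase p q))
  rw [phaseTwirl, LinearMap.smul_apply, LinearMap.sum_apply, Matrix.smul_apply, Matrix.sum_apply]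
  simp only [conjMap_phaseUnitary_apply, ← Finset.sum_mul, hchar, entryPhase_eq_zero_iff]
  split_ifs <;> simp

theorem phaseTwirl_mem_sepCone {X : BipOp ι ι} (hX : X ∈ sepCone ι ι) :
    phaseTwirl X ∈ sepCone ι ι := by
  rw [phaseTwirl, LinearMap.smul_apply, LinearMap.sum_apply]
  exact PointedCone.smul_mem _ (by positivity) <|
    sum_mem fun θ _ => conjMap_kronecker_mem_sepCone _ _ hX

end PhaseTwirl

section Isotropic

theorem diagonal_mem_sepCone {A B : Type} [Fintype A] [Fintype B] [DecidableEq A] [DecidableEq B]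
    {w : A × B → ℂ} (hw : 0 ≤ w) : diagonal w ∈ sepCone A B := by
  have hsum : diagonal w = ∑ p : A × B, diagonal (Pi.single p.1 (w p)) ⊗ₖ
      diagonal (Pi.single p.2 1) := by
    simp only [diagonal_single, single_kronecker_single, mul_one]
    exact (sum_single_eq_diagonal w).symm
  rw [hsum]
  refine sum_mem fun p _ => kronecker_mem_sepCone (.diagonal ?_) (.diagonal ?_)
  · exact Pi.single_nonneg.2 (hw p)
  · exact Pi.single_nonneg.2 zero_le_one

/-- The projector onto the uniform vector `∑ i, |i⟩ / √d`. -/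
noncomputable def uniformProj (d : ℕ) : Matrix (Fin d) (Fin d) ℂ := of fun _ _ => (d : ℂ)⁻¹

theorem isStarProjection_uniformProj (d : ℕ) [NeZero d] : IsStarProjection (uniformProj d) where
  isIdempotentElem := by
    ext
    simp [uniformProj, mul_apply, mul_inv_cancel_left₀ (NeZero.ne (d : ℂ))]
  isSelfAdjoint := by
    ext
    simp [uniformProj]

theorem maxEnt_apply (m : ℕ) (p q : Fin m × Fin m) :
    maxEnt m p q = if p.1 = p.2 ∧ q.1 = q.2 then (m : ℂ)⁻¹ else 0 := by
  have hsqrt : ((√m : ℝ) : ℂ) * (√m : ℝ) = m := by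
    rw [← Complex.ofReal_mul, Real.mul_self_sqrt m.cast_nonneg, Complex.ofReal_natCast]
  simp only [maxEnt, maxEntVec, vecMulVec_apply, Pi.star_apply]
  split_ifs <;> simp_all [← mul_inv]

theorem trace_maxEnt (d : ℕ) [NeZero d] : (maxEnt d).trace = 1 := by
  simp [trace, maxEnt_apply, Fintype.sum_prod_type]

variable {d : ℕ}

theorem maxEnt_add_mem_sepCone [NeZero d] :
    maxEnt d + (d : ℝ)⁻¹ • 1 ∈ sepCone (Fin d) (Fin d) := by
  have hproj := (isStarProjection_uniformProj d).nonneg.posSemidef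
  have heq : maxEnt d + (d : ℝ)⁻¹ • 1 =
      (d : ℝ) • phaseTwirl (uniformProj d ⊗ₖ uniformProj d) +
        diagonal fun p => if p.1 = p.2 then (d : ℂ)⁻¹ else 0 := by
    have : (d : ℂ) ≠ 0 := NeZero.ne _
    ext ⟨i, j⟩ ⟨k, l⟩
    simp only [Matrix.add_apply, Matrix.smul_apply, maxEnt_apply, phaseTwirl_apply, uniformProj,
      kroneckerMap_apply, of_apply, one_apply, diagonal_apply, Complex.real_smul,
      Complex.ofReal_natCast, Complex.ofReal_inv, Prod.mk.injEq]
    grind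
  rw [heq]
  exact add_mem (PointedCone.smul_mem _ d.cast_nonneg
    (phaseTwirl_mem_sepCone (kronecker_mem_sepCone hproj hproj)))
    (diagonal_mem_sepCone fun p => by split_ifs <;> positivity)

theorem one_sub_maxEnt_mem_sepCone [NeZero d] : 1 - maxEnt d ∈ sepCone (Fin d) (Fin d) := by
  have hproj := isStarProjection_uniformProj d
  have heq : 1 - maxEnt d =
      (d : ℝ) • phaseTwirl (uniformProj d ⊗ₖ (1 - uniformProj d)) +
        diagonal fun p => if p.1 = p.2 then 0 else (d : ℂ)⁻¹ := by
    have : (d : ℂ) ≠ 0 := NeZero.ne _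
    ext ⟨i, j⟩ ⟨k, l⟩
    simp only [Matrix.add_apply, Matrix.smul_apply, Matrix.sub_apply, maxEnt_apply,
      phaseTwirl_apply, uniformProj, kroneckerMap_apply, of_apply, one_apply, diagonal_apply,
      Complex.real_smul, Complex.ofReal_natCast, Prod.mk.injEq]
    grind
  rw [heq]
  exact add_mem (PointedCone.smul_mem _ d.cast_nonneg (phaseTwirl_mem_sepCone
    (kronecker_mem_sepCone hproj.nonneg.posSemidef hproj.one_sub.nonneg.posSemidef)))
    (diagonal_mem_sepCone fun p => by split_ifs <;> positivity)

theorem trace_isotropic (hd : 2 ≤ d) (f : ℝ) : (isotropic d f).trace = 1 := by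
  have : NeZero d := ⟨by omega⟩
  have hd' : (2 : ℝ) ≤ d := by exact_mod_cast hd
  have hd1 : (d : ℝ) ^ 2 - 1 ≠ 0 := by nlinarith
  have hd2 : (d : ℂ) ^ 2 - 1 ≠ 0 := by exact_mod_cast hd1
  simp only [isotropic, trace_add, trace_smul, trace_sub, trace_one, trace_maxEnt,
    Fintype.card_prod, Fintype.card_fin, Complex.real_smul]
  push_cast
  field_simp
  ring

theorem isotropic_mem_sepStates (hd : 2 ≤ d) {f : ℝ} (hf0 : 0 ≤ f) (hf : f ≤ 1 / d) :
    isotropic d f ∈ sepStates (Fin d) (Fin d) := by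
  have : NeZero d := ⟨by omega⟩
  have hd' : (2 : ℝ) ≤ d := by exact_mod_cast hd
  have hd1 : 0 < (d : ℝ) - 1 := by linarith
  have hdf : 0 ≤ 1 - d * f := by
    rw [le_div_iff₀ (by linarith)] at hf
    linarith
  have heq : isotropic d f = (f * d / (d + 1)) • (maxEnt d + (d : ℝ)⁻¹ • 1) +
      ((1 - d * f) / ((d - 1) * (d + 1))) • (1 - maxEnt d) := by
    have hfactor : (d : ℝ) ^ 2 - 1 = (d - 1) * (d + 1) := by ring
    rw [isotropic, hfactor]
    match_scalars <;> field_simp <;> ring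
  refine mem_sepStates_iff.2 ⟨?_, trace_isotropic hd f⟩
  rw [heq]
  exact add_mem (PointedCone.smul_mem _ (by positivity) maxEnt_add_mem_sepCone)
    (PointedCone.smul_mem _ (by positivity) one_sub_maxEnt_mem_sepCone)

end Isotropic

section Fidelity

theorem le_one_of_isHermitian_of_mul_self {n : Type} [Fintype n] [DecidableEq n]
    {S : Matrix n n ℂ} (hS : S.IsHermitian) (hSS : S * S = 1) : S ≤ 1 := by
  have hsq : 1 - S = (2⁻¹ : ℝ) • ((1 - S)ᴴ * (1 - S)) := by
    rw [(isHermitian_one.sub hS).eq, Matrix.mul_sub, Matrix.sub_mul, Matrix.sub_mul, hSS,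
      Matrix.one_mul, Matrix.one_mul, Matrix.mul_one]
    module
  rw [le_iff, hsq]
  exact (posSemidef_conjTranspose_mul_self _).smul (by norm_num)

/-- The fidelity with the maximally entangled state `Ψ_m`, as a linear functional. -/
noncomputable def fidelity (m : ℕ) : BipOp (Fin m) (Fin m) →ₗ[ℝ] ℝ where
  toFun X := (Xᴴ * maxEnt m).trace.re
  map_add' X Y := by simp [Matrix.add_mul]
  map_smul' r X := by simp [conjTranspose_smul]

variable {m : ℕ}

theorem fidelity_apply (X : BipOp (Fin m) (Fin m)) : fidelity m X = (Xᴴ * maxEnt m).trace.re := rfl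

theorem fidelity_le_trace [NeZero m] {X : BipOp (Fin m) (Fin m)} (hX : X.PosSemidef) :
    fidelity m X ≤ X.trace.re := by
  have h := re_trace_mul_nonneg hX (posSemidef_of_mem_sepCone (one_sub_maxEnt_mem_sepCone (d := m)))
  rw [Matrix.mul_sub, Matrix.mul_one, trace_sub, Complex.sub_re, sub_nonneg] at h
  rwa [fidelity_apply, hX.isHermitian.eq]

theorem partialTranspose_maxEnt (m : ℕ) :
    partialTranspose (maxEnt m) = (m : ℝ)⁻¹ • Equiv.Perm.permMatrix ℂ (Equiv.prodComm _ _) := by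
  ext ⟨i, j⟩ ⟨k, l⟩
  simp only [partialTranspose, of_apply, maxEnt_apply, Matrix.smul_apply, Equiv.Perm.permMatrix,
    PEquiv.toMatrix_apply, Equiv.toPEquiv_apply, Equiv.prodComm_apply, Prod.swap_prod_mk,
    Option.mem_def, Option.some.injEq, Prod.mk.injEq, Complex.real_smul, Complex.ofReal_inv,
    Complex.ofReal_natCast]
  grind

theorem fidelity_le_of_mem_rainsSet {X : BipOp (Fin m) (Fin m)}
    (hX : X ∈ rainsSet (Fin m) (Fin m)) : fidelity m X ≤ (m : ℝ)⁻¹ := by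
  let S : BipOp (Fin m) (Fin m) := Equiv.Perm.permMatrix ℂ (Equiv.prodComm _ _)
  have hS : S.IsHermitian := conjTranspose_permMatrix (Equiv.prodComm _ _)
  have hSS : S * S = 1 := (permMatrix_mul _ _).symm.trans permMatrix_one
  have hneg : -1 ≤ S :=
    neg_le.1 (le_one_of_isHermitian_of_mul_self hS.neg (by rw [neg_mul_neg, hSS]))
  calc fidelity m X = (partialTranspose X * partialTranspose (maxEnt m)).trace.re := by
        rw [trace_partialTranspose_mul_partialTranspose, fidelity_apply, hX.1.isHermitian.eq]
    _ = (m : ℝ)⁻¹ * (partialTranspose X * S).trace.re := by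
        rw [partialTranspose_maxEnt, Matrix.mul_smul, trace_smul, Complex.smul_re, smul_eq_mul]
    _ ≤ (m : ℝ)⁻¹ := mul_le_of_le_one_right (by positivity) <|
        (re_trace_mul_le_traceNorm (isHermitian_partialTranspose hX.1.isHermitian) hneg
          (le_one_of_isHermitian_of_mul_self hS hSS)).trans hX.2

end Fidelity

section SeparableMaps

variable {A B A' B' : Type} [DecidableEq A] [DecidableEq B]

/-- The Choi matrix as a linear function of the map. -/
def choiLM : BipMap A B A' B' →ₗ[ℂ] BipOp (A × A') (B × B') where
  toFun := choi
  map_add' _ _ := rfl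
  map_smul' _ _ := rfl

variable [Fintype A] [Fintype B] [Fintype A'] [Fintype B']

variable (A' B' A B) in
/-- The cone of separable maps: those with separable Choi matrix, not necessarily trace
preserving. -/
noncomputable def sepMaps : PointedCone ℝ (BipMap A B A' B') :=
  (sepCone (A × A') (B × B')).comap (choiLM.restrictScalars ℝ)

theorem mem_sepOps_of_mem_sepMaps [Nonempty A] [Nonempty B] [Nonempty A'] [Nonempty B']
    {Λ : BipMap A B A' B'} (hΛ : Λ ∈ sepMaps A B A' B') (htr : ∀ X, (Λ X).trace = X.trace) :
    Λ ∈ sepOps A B A' B' := by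
  refine ⟨⟨fun k M hM => ?_, htr⟩, exists_eq_smul_sepStates hΛ⟩
  rw [← choiMap_choi Λ]
  exact posSemidef_ampliation_choiAction k ((posSemidef_of_mem_sepCone hΛ).submatrix _) hM

theorem conjMap_kronecker_mem_sepMaps (S : Matrix A' A ℂ) (T : Matrix B' B ℂ) :
    conjMap (S ⊗ₖ T) ∈ sepMaps A B A' B' := by
  let φ (p : A × A') : ℂ := S p.2 p.1
  let η (p : B × B') : ℂ := T p.2 p.1
  have hchoi : choi (conjMap (S ⊗ₖ T)) = vecMulVec φ (star φ) ⊗ₖ vecMulVec η (star η) := by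
    ext p q
    simp [choi, φ, η, vecMulVec_apply, mul_apply, single_apply, ite_and, mul_mul_mul_comm]
  change choi (conjMap (S ⊗ₖ T)) ∈ sepCone (A × A') (B × B')
  exact hchoi ▸ vecMulVec_kronecker_mem_sepCone φ η

end SeparableMaps

section SingleKraus

variable {A B A' B' : Type} [Fintype A] [DecidableEq A] [Fintype B] [DecidableEq B]

theorem conjMap_single_kronecker_single [DecidableEq A'] [DecidableEq B'] (i : A') (j : B')
    (a : A) (b : B) (X : BipOp A B) :
    conjMap (single i a 1 ⊗ₖ single j b 1) X = single (i, j) (i, j) (X (a, b) (a, b)) := by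
  rw [conjMap_apply, single_kronecker_single, conjTranspose_single, single_mul_mul_single]
  simp

theorem conjMap_submatrix_one_kronecker (f : A' → A) (g : B' → B) (X : BipOp A B) :
    conjMap ((1 : Matrix A A ℂ).submatrix f id ⊗ₖ (1 : Matrix B B ℂ).submatrix g id) X =
      X.submatrix (Prod.map f g) (Prod.map f g) := by
  ext p q
  simp [mul_apply, Fintype.sum_prod_type, one_apply, apply_ite, Prod.map]

end SingleKraus

section Protocols

variable {A B I κ ι : Type} [Fintype A] [DecidableEq A] [DecidableEq I]

section Prepare

variable [Fintype B] [DecidableEq B]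

/-- The channel that measures the input in the product basis, discards the result and prepares the
product state `|ii⟩`. -/
noncomputable def prepareMap (i : I) : BipMap A B I I :=
  ∑ p : A × B, conjMap (single i p.1 1 ⊗ₖ single i p.2 1)

theorem prepareMap_apply (i : I) (X : BipOp A B) :
    prepareMap i X = single (i, i) (i, i) X.trace := by
  simp only [prepareMap, LinearMap.sum_apply, conjMap_single_kronecker_single, trace, diag_apply]
  exact (map_sum (singleLinearMap ℂ (α := ℂ) (i, i) (i, i)) _ _).symm

theorem prepareMap_mem_sepOps [Fintype I] [Nonempty A] [Nonempty B] (i : I) :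
    prepareMap i ∈ sepOps A B I I := by
  have : Nonempty I := ⟨i⟩
  refine mem_sepOps_of_mem_sepMaps (sum_mem fun p _ => conjMap_kronecker_mem_sepMaps _ _)
    fun X => ?_
  rw [prepareMap_apply, trace_single_eq_same]

end Prepare

variable [Fintype I] [Fintype ι] [Fintype κ]

/-- Let `P k` be the projection onto the block `e k ∘ Sum.inl` of basis vectors. The first party
applies the measurement with effects `P k / card I`, and the second party tests `P k` for the
outcome `k` of the first. If the test succeeds they keep their state, otherwise they prepare `|ii⟩`.
The effects add up to `1` when each position of the block runs once through all basis vectors as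
`k` varies. -/
noncomputable def blockMap (e : ι → I ⊕ κ ≃ A) (i : I) : BipMap A A I I :=
  (Fintype.card I : ℝ)⁻¹ • ∑ k,
    (conjMap ((1 : Matrix A A ℂ).submatrix (e k ∘ Sum.inl) id ⊗ₖ
        (1 : Matrix A A ℂ).submatrix (e k ∘ Sum.inl) id) +
      ∑ s : I × κ, conjMap (single i (e k (Sum.inl s.1)) 1 ⊗ₖ single i (e k (Sum.inr s.2)) 1))

theorem blockMap_apply (e : ι → I ⊕ κ ≃ A) (i : I) (X : BipOp A A) :
    blockMap e i X = (Fintype.card I : ℝ)⁻¹ • ∑ k,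
      (X.submatrix (Prod.map (e k ∘ Sum.inl) (e k ∘ Sum.inl))
          (Prod.map (e k ∘ Sum.inl) (e k ∘ Sum.inl)) +
        ∑ s : I × κ, single (i, i) (i, i)
          (X (e k (Sum.inl s.1), e k (Sum.inr s.2)) (e k (Sum.inl s.1), e k (Sum.inr s.2)))) := by
  simp only [blockMap, LinearMap.smul_apply, LinearMap.sum_apply, LinearMap.add_apply,
    conjMap_submatrix_one_kronecker, conjMap_single_kronecker_single]

theorem trace_blockMap {e : ι → I ⊕ κ ≃ A}
    (he : ∀ j, Function.Bijective fun k => e k (Sum.inl j)) (i : I) (X : BipOp A A) :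
    (blockMap e i X).trace = X.trace := by
  have hblock (k : ι) : ∑ j : I × I, X (e k (Sum.inl j.1), e k (Sum.inl j.2))
        (e k (Sum.inl j.1), e k (Sum.inl j.2)) +
      ∑ s : I × κ, X (e k (Sum.inl s.1), e k (Sum.inr s.2))
        (e k (Sum.inl s.1), e k (Sum.inr s.2)) =
      ∑ j, ∑ b, X (e k (Sum.inl j), b) (e k (Sum.inl j), b) := by
    simp only [Fintype.sum_prod_type, ← Finset.sum_add_distrib]
    refine Finset.sum_congr rfl fun j _ => ?_
    rw [← (e k).sum_comp fun b => X (e k (Sum.inl j), b) (e k (Sum.inl j), b)]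
    exact (Fintype.sum_sum_type fun t =>
      X (e k (Sum.inl j), e k t) (e k (Sum.inl j), e k t)).symm
  have hcover : ∑ k, ∑ j, ∑ b, X (e k (Sum.inl j), b) (e k (Sum.inl j), b) =
      Fintype.card I * X.trace := by
    rw [Finset.sum_comm, trace, Fintype.sum_prod_type]
    simp only [(he _).sum_comp fun a => ∑ b, X (a, b) (a, b), diag_apply]
    simp
  have : Nonempty I := ⟨i⟩
  rw [blockMap_apply]
  simp only [trace_smul, trace_sum, trace_add, trace_single_eq_same]
  simp only [trace, diag_apply, submatrix_apply, Prod.map, Function.comp_apply, hblock]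
  rw [hcover]
  simp [trace]

theorem blockMap_mem_sepOps [Nonempty A] {e : ι → I ⊕ κ ≃ A}
    (he : ∀ j, Function.Bijective fun k => e k (Sum.inl j)) (i : I) :
    blockMap e i ∈ sepOps A A I I := by
  have : Nonempty I := ⟨i⟩
  refine mem_sepOps_of_mem_sepMaps ?_ (trace_blockMap he i)
  exact PointedCone.smul_mem (sepMaps A A I I) (inv_nonneg.2 (Nat.cast_nonneg _)) <|
    sum_mem fun k _ => add_mem (conjMap_kronecker_mem_sepMaps _ _)
      (sum_mem fun s _ => conjMap_kronecker_mem_sepMaps _ _)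

end Protocols

section FidelityValues

variable {d m : ℕ}

theorem fidelity_eq_sum (X : BipOp (Fin m) (Fin m)) :
    fidelity m X = (m : ℝ)⁻¹ * ∑ i, ∑ j, (X (i, i) (j, j)).re := by
  rw [fidelity_apply, Finset.sum_comm]
  simp [trace, mul_apply, Fintype.sum_prod_type, maxEnt_apply, ite_and, Finset.mul_sum, mul_comm]

theorem fidelity_single (i : Fin m) (c : ℂ) :
    fidelity m (single (i, i) (i, i) c) = c.re / m := by
  simp [fidelity_eq_sum, single_apply, ite_and, apply_ite, div_eq_inv_mul]

theorem fidelity_submatrix_maxEnt (f : Fin m → Fin d) :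
    fidelity m ((maxEnt d).submatrix (Prod.map f f) (Prod.map f f)) = m / d := by
  rcases eq_or_ne d 0 with rfl | hd
  · simp [fidelity_eq_sum, maxEnt_apply]
  · simp [fidelity_eq_sum, maxEnt_apply, div_eq_mul_inv, ← mul_assoc, hd]

theorem fidelity_submatrix_one [NeZero m] {f : Fin m → Fin d} (hf : Function.Injective f) :
    fidelity m ((1 : BipOp (Fin d) (Fin d)).submatrix (Prod.map f f) (Prod.map f f)) = 1 := by
  simp [fidelity_eq_sum, one_apply, hf.eq_iff, apply_ite]

end FidelityValues

section CyclicBlocks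

variable {d m : ℕ}

/-- The splitting of the basis into the cyclic interval of length `m` starting at `k` and its
complement. -/
def cyclicBlock [NeZero d] (hmd : m ≤ d) (k : Fin d) : Fin m ⊕ Fin (d - m) ≃ Fin d :=
  (finSumFinEquiv.trans (finCongr (Nat.add_sub_cancel' hmd))).trans (Equiv.addLeft k)

theorem bijective_cyclicBlock_inl [NeZero d] (hmd : m ≤ d) (j : Fin m) :
    Function.Bijective fun k => cyclicBlock hmd k (Sum.inl j) :=
  (Equiv.addRight _).bijective

theorem fidelity_blockMap_maxEnt [NeZero d] [NeZero m] (hmd : m ≤ d) (i : Fin m) :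
    fidelity m (blockMap (cyclicBlock hmd) i (maxEnt d)) = 1 := by
  have hfail (k : Fin d) (s : Fin m × Fin (d - m)) :
      cyclicBlock hmd k (Sum.inl s.1) ≠ cyclicBlock hmd k (Sum.inr s.2) :=
    (cyclicBlock hmd k).injective.ne Sum.inl_ne_inr
  simp only [blockMap_apply, map_smul, map_sum, map_add, fidelity_submatrix_maxEnt,
    fidelity_single, maxEnt_apply, hfail, and_self, if_false, Complex.zero_re, zero_div,
    Finset.sum_const_zero, add_zero, Fin.sum_const, nsmul_eq_mul, smul_eq_mul, Fintype.card_fin]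
  have := NeZero.ne (m : ℝ)
  have := NeZero.ne (d : ℝ)
  field_simp

theorem fidelity_blockMap_one [NeZero d] [NeZero m] (hmd : m ≤ d) (i : Fin m) :
    fidelity m (blockMap (cyclicBlock hmd) i 1) = d / m * (1 + d - m) := by
  have hinj (k : Fin d) : Function.Injective (cyclicBlock hmd k ∘ Sum.inl) :=
    (cyclicBlock hmd k).injective.comp Sum.inl_injective
  simp only [blockMap_apply, map_smul, map_sum, map_add, fidelity_submatrix_one (hinj _),
    fidelity_single, one_apply_eq, Complex.one_re]
  simp only [Finset.sum_const, Finset.card_univ,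
    Fintype.card_prod, Fintype.card_fin, nsmul_eq_mul, smul_eq_mul, Nat.cast_mul, Nat.cast_sub hmd]
  have := NeZero.ne (m : ℝ)
  field_simp
  ring

end CyclicBlocks

section Distillation

theorem fidelityOfDistillation_eq {A B : Type} {m : ℕ} {O : Set (BipMap A B (Fin m) (Fin m))}
    {ρ : BipOp A B} {F : ℝ} (hle : ∀ Λ ∈ O, fidelity m (Λ ρ) ≤ F)
    (hex : ∃ Λ ∈ O, fidelity m (Λ ρ) = F) : fidelityOfDistillation O ρ = F :=
  IsGreatest.csSup_eq ⟨hex, Set.forall_mem_image.2 hle⟩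

variable {d m : ℕ}

theorem fidelity_prepareMap {A B : Type} [Fintype A] [DecidableEq A] [Fintype B] [DecidableEq B]
    (i : Fin m) (ρ : BipOp A B) : fidelity m (prepareMap i ρ) = ρ.trace.re / m := by
  rw [prepareMap_apply, fidelity_single]

theorem fidelity_map_smul_add_smul {A B : Type} (Λ : BipMap A B (Fin m) (Fin m)) (a b : ℝ)
    (X Y : BipOp A B) :
    fidelity m (Λ (a • X + b • Y)) = a * fidelity m (Λ X) + b * fidelity m (Λ Y) := by
  simp only [map_add, LinearMap.map_smul_of_tower, smul_eq_mul]

theorem isotropic_eq_maxEnt_add (hd : 2 ≤ d) (f : ℝ) :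
    isotropic d f = ((d * f - 1) / (d - 1) : ℝ) • maxEnt d +
      (d * (1 - f) / (d - 1) : ℝ) • isotropic d (1 / d) := by
  have hd' : (2 : ℝ) ≤ d := by exact_mod_cast hd
  have h1 : (d : ℝ) - 1 ≠ 0 := by linarith
  have h2 : (d : ℝ) ^ 2 - 1 ≠ 0 := by nlinarith
  simp only [isotropic]
  match_scalars
  · field_simp
    ring
  · field_simp

theorem isotropic_eq_maxEnt_add_one (d : ℕ) (f : ℝ) :
    isotropic d f = (f - (1 - f) / ((d : ℝ) ^ 2 - 1)) • maxEnt d +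
      ((1 - f) / ((d : ℝ) ^ 2 - 1)) • (1 : BipOp (Fin d) (Fin d)) := by
  rw [isotropic]
  module

theorem fidelity_isotropic_le [NeZero m] (hd : 2 ≤ d) {f : ℝ} (hf : 1 / d ≤ f) (hf1 : f ≤ 1)
    {Λ : BipMap (Fin d) (Fin d) (Fin m) (Fin m)}
    (hΛ : Λ ∈ sepToRainsOps (Fin d) (Fin d) (Fin m) (Fin m)) :
    fidelity m (Λ (isotropic d f)) ≤
      (d * f - 1) / (d - 1) + d * (1 - f) / (m * (d - 1)) := by
  have : NeZero d := ⟨by omega⟩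
  have hd' : (2 : ℝ) ≤ d := by exact_mod_cast hd
  have hmax : fidelity m (Λ (maxEnt d)) ≤ 1 := by
    have hΨ : (maxEnt d).PosSemidef := posSemidef_vecMulVec_self_star (maxEntVec d)
    simpa [hΛ.1.tracePreserving, trace_maxEnt] using fidelity_le_trace (hΛ.1.posSemidef hΨ)
  have hsep : fidelity m (Λ (isotropic d (1 / d))) ≤ (m : ℝ)⁻¹ :=
    fidelity_le_of_mem_rainsSet (hΛ.2 _ (isotropic_mem_sepStates hd (by positivity) le_rfl))
  rw [div_le_iff₀ (by linarith)] at hf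
  calc fidelity m (Λ (isotropic d f))
      = (d * f - 1) / (d - 1) * fidelity m (Λ (maxEnt d)) +
          d * (1 - f) / (d - 1) * fidelity m (Λ (isotropic d (1 / d))) := by
        rw [isotropic_eq_maxEnt_add hd, fidelity_map_smul_add_smul]
    _ ≤ (d * f - 1) / (d - 1) * 1 + d * (1 - f) / (d - 1) * (m : ℝ)⁻¹ := by
        gcongr
        · exact div_nonneg (by linarith) (by linarith)
        · exact div_nonneg (mul_nonneg (by linarith) (by linarith)) (by linarith)
    _ = (d * f - 1) / (d - 1) + d * (1 - f) / (m * (d - 1)) := by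
        field_simp

theorem fidelity_blockMap_isotropic [NeZero d] [NeZero m] (hd : 2 ≤ d) (hmd : m ≤ d) (i : Fin m)
    (f : ℝ) : fidelity m (blockMap (cyclicBlock hmd) i (isotropic d f)) =
      (d * f - 1) / (d - 1) + d * (1 - f) / (m * (d - 1)) := by
  have hd' : (2 : ℝ) ≤ d := by exact_mod_cast hd
  have hm0 := NeZero.ne (m : ℝ)
  have h1 : (d : ℝ) - 1 ≠ 0 := by linarith
  have h2 : (d : ℝ) + 1 ≠ 0 := by linarith
  have hfactor : (d : ℝ) ^ 2 - 1 = (d - 1) * (d + 1) := by ring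
  rw [isotropic_eq_maxEnt_add_one, fidelity_map_smul_add_smul, fidelity_blockMap_maxEnt,
    fidelity_blockMap_one, hfactor]
  field_simp
  ring

variable {f : ℝ} {O : Set (BipMap (Fin d) (Fin d) (Fin m) (Fin m))}

theorem fidelityOfDistillation_isotropic_of_le [NeZero m] (hd : 2 ≤ d) (hf0 : 0 ≤ f)
    (hf : f ≤ 1 / d) (hO : O ∈ Set.Icc (sepOps (Fin d) (Fin d) (Fin m) (Fin m))
      (sepToRainsOps (Fin d) (Fin d) (Fin m) (Fin m))) :
    fidelityOfDistillation O (isotropic d f) = 1 / m := by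
  have : NeZero d := ⟨by omega⟩
  refine fidelityOfDistillation_eq (fun Λ hΛ => ?_) ⟨_, hO.1 (prepareMap_mem_sepOps 0), ?_⟩
  · rw [one_div]
    exact fidelity_le_of_mem_rainsSet ((hO.2 hΛ).2 _ (isotropic_mem_sepStates hd hf0 hf))
  · rw [fidelity_prepareMap, trace_isotropic hd, Complex.one_re]

theorem fidelityOfDistillation_isotropic_of_ge [NeZero m] (hd : 2 ≤ d) (hmd : m ≤ d)
    (hf : 1 / d ≤ f) (hf1 : f ≤ 1) (hO : O ∈ Set.Icc (sepOps (Fin d) (Fin d) (Fin m) (Fin m))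
      (sepToRainsOps (Fin d) (Fin d) (Fin m) (Fin m))) :
    fidelityOfDistillation O (isotropic d f) =
      (d * f - 1) / (d - 1) + d * (1 - f) / (m * (d - 1)) := by
  have : NeZero d := ⟨by omega⟩
  exact fidelityOfDistillation_eq (fun Λ hΛ => fidelity_isotropic_le hd hf hf1 (hO.2 hΛ))
    ⟨_, hO.1 (blockMap_mem_sepOps (bijective_cyclicBlock_inl hmd) 0),
      fidelity_blockMap_isotropic hd hmd 0 f⟩

end Distillation

end EntDist

theorem mainTheorem4_general (d m : ℕ) (hd : 2 ≤ d) (hm : 1 ≤ m) (f : ℝ) (hf0 : 0 ≤ f)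
    (hf1 : f ≤ 1) (O : Set (EntDist.BipMap (Fin d) (Fin d) (Fin m) (Fin m)))
    (hO : O ∈ Set.Icc (EntDist.sepOps (Fin d) (Fin d) (Fin m) (Fin m))
      (EntDist.sepToRainsOps (Fin d) (Fin d) (Fin m) (Fin m))) :
    (f ≤ 1 / (d : ℝ) →
      EntDist.fidelityOfDistillation O (EntDist.isotropic d f) = 1 / (m : ℝ)) ∧
    (m ≤ d → 1 / (d : ℝ) ≤ f →
      EntDist.fidelityOfDistillation O (EntDist.isotropic d f) =
        ((d : ℝ) * f - 1) / ((d : ℝ) - 1) +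
          (d : ℝ) * (1 - f) / ((m : ℝ) * ((d : ℝ) - 1))) := by
  have : NeZero m := ⟨by omega⟩
  exact ⟨fun hf => EntDist.fidelityOfDistillation_isotropic_of_le hd hf0 hf hO,
    fun hmd hf => EntDist.fidelityOfDistillation_isotropic_of_ge hd hmd hf hf1 hO⟩

theorem mainTheorem4 (d m : ℕ) (hd : 2 ≤ d) (hm : 1 ≤ m) (f : ℝ) (hf0 : 0 ≤ f) (hf1 : f ≤ 1)
    (O : Set (EntDist.BipMap (Fin d) (Fin d) (Fin m) (Fin m)))
    (hO : O ∈ ({EntDist.sepOps (Fin d) (Fin d) (Fin m) (Fin m),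
        EntDist.pptOps (Fin d) (Fin d) (Fin m) (Fin m),
        EntDist.rainsPreservingOps (Fin d) (Fin d) (Fin m) (Fin m),
        EntDist.pptPlusPreservingOps (Fin d) (Fin d) (Fin m) (Fin m),
        EntDist.sepPreservingOps (Fin d) (Fin d) (Fin m) (Fin m)} :
          Set (Set (EntDist.BipMap (Fin d) (Fin d) (Fin m) (Fin m))))) :
    (f ≤ 1 / (d : ℝ) →
      EntDist.fidelityOfDistillation O (EntDist.isotropic d f) = 1 / (m : ℝ)) ∧
    (m ≤ d → 1 / (d : ℝ) ≤ f →
      EntDist.fidelityOfDistillation O (EntDist.isotropic d f) =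
        ((d : ℝ) * f - 1) / ((d : ℝ) - 1) +
          (d : ℝ) * (1 - f) / ((m : ℝ) * ((d : ℝ) - 1))) := by
  have : NeZero m := ⟨by omega⟩
  exact mainTheorem4_general d m hd hm f hf0 hf1 O (EntDist.mem_Icc_sepOps_sepToRainsOps hO)
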